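/- **Setting.** Let $\lambda>0$, $0<p_a\le 1$, $n_{\rm AR}\in\{1,2,\dots\}$, $d_{\mathcal A}>0$, $d_{\rm safe}\ge 0$, $d_{\max}>0$, $\tau>0$, $\alpha>0$, $\rho_{\rm VT}>0$. For $c\in\mathbb Z$ let $\mathcal A_c=[c\,n_{\rm AR}d_{\mathcal A}-\tfrac{d_{\mathcal A}}2,\;c\,n_{\rm AR}d_{\mathcal A}+\tfrac{d_{\mathcal A}}2)$ be the $c$-th co-channel segment of a lane and $\mathcal A=\bigcup_{c\in\mathbb Z}\mathcal A_c$. Let the active vehicles $\mathrm{VT}_0',\mathrm{VT}_1',\dots$ of the lane form a homogeneous Poisson point process on $\mathbb R$ with density $\lambda p_a$, and let $H_0,H_1,\dots$ be i.i.d. exponential random variables with mean one that are independent of the process. For a probe receiver at $x\in\mathbb R$ and a probe transmitter at $v\in\mathbb R$ the interference under multi-lane partition is $$I(x)=\sum_i H_i\,(\tau|\mathrm{VT}_i'-x|)^{-\alpha}\rho_{\rm VT}\,\mathbf 1(\mathrm{VT}_i'\in\mathcal A)\,\mathbf 1(|\mathrm{VT}_i'-x|\le d_{\max})\,\mathbf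 1(|\mathrm{VT}_i'-x|>d_{\rm safe})\,\mathbf 1(|\mathrm{VT}_i'-v|>d_{\rm safe}).$$ Put $\ell_c=\max(c\,n_{\rm AR}d_{\mathcal A}-\tfrac{d_{\mathcal A}}2-x,\,-d_{\max})$ and $r_c=\min(c\,n_{\rm AR}d_{\mathcal A}+\tfrac{d_{\mathcal A}}2-x,\,d_{\max})$, and $$\begin{aligned} \mu_L^{(1,1)}&=\max(\ell_c,\,d_{\rm safe},\,d_{\rm safe}-x+v), & \mu_U^{(1,1)}&=r_c,\\ \mu_L^{(2,1)}&=\max(\ell_c,\,d_{\rm safe}), & \mu_U^{(2,1)}&=\min(r_c,\,v-x-d_{\rm safe}),\\ \mu_L^{(1,2)}&=-\min(r_c,\,-d_{\rm safe}), & \mu_U^{(1,2)}&=-\max(\ell_c,\,d_{\rm safe}-x+v),\\ \mu_L^{(2,2)}&=-\min(r_c,\,-d_{\rm safe},\,v-x-d_{\rm safe}), & \mu_U^{(2,2)}&=-\ell_c . \end{aligned}$$ With the Gauss hypergeometric function ${}_2F_1$ (analytically continued to $(-\infty,1)$) put $$\zeta(c,s,x)=\sum_{i,j\in\{1,2\}}\mathbf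 1\big(\mu_L^{(i,j)}<\mu_U^{(i,j)}\big)\Big(g_s(\mu_U^{(i,j)})-g_s(\mu_L^{(i,j)})\Big),\qquad g_s(\mu)=\mu\;{}_2F_1\Big(1,\tfrac1\alpha;1+\tfrac1\alpha;\tfrac{(\tau\mu)^\alpha}{-s\,\rho_{\rm VT}}\Big).$$ **Lemma.** For all $x,v\in\mathbb R$ the sum $I(x)$ converges almost surely. For every $s>0$ only finitely many $\zeta(c,s,x)$, $c\in\mathbb Z$, are nonzero, and the Laplace transform of the interference is $$\mathcal L_{I(x)}(s)=\mathbb E\big[e^{-sI(x)}\big]=\exp\Big(-\lambda p_a\sum_{c\in\mathbb Z}\zeta(c,s,x)\Big).$$ With $D=d_{\max}/(n_{\rm AR}d_{\mathcal A})$, the sum may be restricted to the range $-\lfloor D\rfloor\le c\le\lceil D\rceil$, i.e. $$\mathcal L_{I(x)}(s)=\exp\Big(-\lambda p_a\sum_{c=-\lfloor D\rfloor}^{\lceil D\rceil}\zeta(c,s,x)\Big),$$ whenever the co-channel segments outside this range are out of reach of the receiver, that is, whenever $d_{\max}-x\le(\lfloor D\rfloor+1)\,n_{\rm AR}d_{\mathcal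 A}-\tfrac{d_{\mathcal A}}2$ and $d_{\max}+x\le(\lceil D\rceil+1)\,n_{\rm AR}d_{\mathcal A}-\tfrac{d_{\mathcal A}}2$. -/

import Mathlib

open MeasureTheory ProbabilityTheory Set

/-! ### The Gauss hypergeometric function on the real half-line `z < 1` -/

/-- `F` continues the Gauss series `∑ (a)ₙ (b)ₙ / (c)ₙ zⁿ / n!` analytically from `(-1, 1)` to the
half-line `(-∞, 1)`.  (On `(-1, 1)` Mathlib's `₂F₁` is the sum of this series.) -/
def IsGaussContinuation (a b c : ℝ) (F : ℝ → ℝ) : Prop :=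
  AnalyticOnNhd ℝ F (Iio 1) ∧ ∀ z ∈ Ioo (-1 : ℝ) 1, F z = ₂F₁ a b c z

/-- The analytic continuation is unique. -/
theorem IsGaussContinuation.eqOn {a b c : ℝ} {F G : ℝ → ℝ} (hF : IsGaussContinuation a b c F)
    (hG : IsGaussContinuation a b c G) : EqOn F G (Iio 1) := by
  refine hF.1.eqOn_of_preconnected_of_eventuallyEq hG.1 isPreconnected_Iio
    (z₀ := 0) (by simp) ?_
  filter_upwards [Ioo_mem_nhds (show (-1 : ℝ) < 0 by norm_num) (show (0 : ℝ) < 1 by norm_num)]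
    with z hz
  rw [hF.2 z hz, hG.2 z hz]

open Classical in
/-- The Gauss hypergeometric function `₂F₁(a, b; c; z)` for real parameters and real `z < 1`: the
analytic continuation of the Gauss series.  (Mathlib's `₂F₁` is the sum of the series only, so it is
not the hypergeometric function for `z < -1`.) -/
noncomputable def gaussF (a b c z : ℝ) : ℝ :=
  if h : ∃ F : ℝ → ℝ, IsGaussContinuation a b c F then h.choose z else 0

/-! ### Poisson point processes on the line -/

/-- The number of points of the random sequence `X` that lie in `A`. -/
noncomputable def pointCount {Ω : Type*} (X : ℕ → Ω → ℝ) (A : Set ℝ) (ω : Ω) : ℕ∞ :=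
  {i : ℕ | X i ω ∈ A}.encard

/-- The points `X 0, X 1, …` form a Poisson point process on `ℝ` with intensity measure `ν`
(of infinite total mass): counts in sets of finite intensity are Poisson variables, and counts in
disjoint sets are independent. -/
structure IsPoissonProcess {Ω : Type*} [MeasurableSpace Ω] (P : Measure Ω) (X : ℕ → Ω → ℝ)
    (ν : Measure ℝ) : Prop where
  measurable : ∀ i, Measurable (X i)
  poisson : ∀ A : Set ℝ, MeasurableSet A → ν A ≠ ⊤ →
    HasLaw (pointCount X A) ((poissonMeasure (ν A).toNNReal).map (Nat.cast : ℕ → ℕ∞)) P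
  indep : ∀ (n : ℕ) (A : Fin n → Set ℝ), (∀ k, MeasurableSet (A k)) →
    Pairwise (fun k l => Disjoint (A k) (A l)) → iIndepFun (fun k => pointCount X (A k)) P

/-- `H 0, H 1, …` is Rayleigh fading for the points `X 0, X 1, …`: the power gains are i.i.d.
exponential with mean one and independent of the point process. -/
structure IsRayleighFading {Ω : Type*} [MeasurableSpace Ω] (P : Measure Ω) (X H : ℕ → Ω → ℝ) :
    Prop where
  exponential : ∀ i, HasLaw (H i) (expMeasure 1) P
  indep : iIndepFun H P
  indep_points : IndepFun (fun ω i => H i ω) (fun ω i => X i ω) P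

/-! ### The road with multi-lane partition -/

/-- The numerical parameters of a lane. -/
structure LaneParams where
  /-- density of the vehicles of the lane -/
  lam : ℝ
  /-- probability that a vehicle is active -/
  pa : ℝ
  /-- number of access resources of the lane -/
  nAR : ℕ
  /-- length of a segment -/
  dA : ℝ
  /-- safe distance -/
  dsafe : ℝ
  /-- maximum communication distance -/
  dmax : ℝ
  /-- path loss slope -/
  tau : ℝ
  /-- path loss exponent -/
  alpha : ℝ
  /-- transmit power per Hz -/
  rho : ℝ

namespace LaneParams

variable (M : LaneParams)

/-- The `c`-th co-channel segment; the probe segment `c = 0` is centered at the origin. -/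
def segment (c : ℤ) : Set ℝ :=
  Ico (c * M.nAR * M.dA - M.dA / 2) (c * M.nAR * M.dA + M.dA / 2)

/-- The union of all co-channel segments. -/
def coChannel : Set ℝ := ⋃ c : ℤ, M.segment c

/-- The positions `y` at which an active vehicle interferes with the receiver at `x`, when the
probe transmitter is at `v`. -/
def interferers (x v : ℝ) : Set ℝ :=
  {y | y ∈ M.coChannel ∧ |y - x| ≤ M.dmax ∧ M.dsafe < |y - x| ∧ M.dsafe < |y - v|}

open Classical in
/-- The power received at `x` from an active vehicle at `y` with fading gain `h`, as it enters the
interference. -/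
noncomputable def received (x v y h : ℝ) : ℝ :=
  if y ∈ M.interferers x v then h * (M.tau * |y - x|) ^ (-M.alpha) * M.rho else 0

/-- The interference at `x` when the probe transmitter is at `v`, the active vehicles are at the
points `X i`, and their fading gains are `H i`. -/
noncomputable def interference {Ω : Type*} (X H : ℕ → Ω → ℝ) (x v : ℝ) (ω : Ω) : ℝ :=
  ∑' i, M.received x v (X i ω) (H i ω)

/-- Left end of the `c`-th segment, relative to `x` and cut at distance `dmax`. -/
noncomputable def left (c : ℤ) (x : ℝ) : ℝ :=
  max (c * M.nAR * M.dA - M.dA / 2 - x) (-M.dmax)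

/-- Right end of the `c`-th segment, relative to `x` and cut at distance `dmax`. -/
noncomputable def right (c : ℤ) (x : ℝ) : ℝ :=
  min (c * M.nAR * M.dA + M.dA / 2 - x) M.dmax

/-- Smallest distance to `x` in the sub-interval `(i, j)` of the `c`-th segment.  First index:
right (`0`) or left (`1`) of the transmitter; second index: right (`0`) or left (`1`) of the
receiver.  -/
noncomputable def muL (c : ℤ) (x v : ℝ) : Fin 2 → Fin 2 → ℝ
  | 0, 0 => max (M.left c x) (max M.dsafe (M.dsafe - x + v))
  | 1, 0 => max (M.left c x) M.dsafe
  | 0, 1 => -min (M.right c x) (-M.dsafe)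
  | 1, 1 => -min (M.right c x) (min (-M.dsafe) (v - x - M.dsafe))

/-- Largest distance to `x` in the sub-interval `(i, j)` of the `c`-th segment. -/
noncomputable def muU (c : ℤ) (x v : ℝ) : Fin 2 → Fin 2 → ℝ
  | 0, 0 => M.right c x
  | 1, 0 => min (M.right c x) (v - x - M.dsafe)
  | 0, 1 => -max (M.left c x) (M.dsafe - x + v)
  | 1, 1 => -M.left c x

/-- `μ ₂F₁(1, 1/α; 1 + 1/α; (τ μ)^α / (-s ρ))`. -/
noncomputable def hyperTerm (s mu : ℝ) : ℝ :=
  mu * gaussF 1 (1 / M.alpha) (1 + 1 / M.alpha) ((M.tau * mu) ^ M.alpha / (-(s * M.rho)))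

/-- The function `ζ(c, s, x)`, for the probe transmitter at `v`. -/
noncomputable def zeta (c : ℤ) (s x v : ℝ) : ℝ :=
  ∑ i : Fin 2, ∑ j : Fin 2,
    if M.muL c x v i j < M.muU c x v i j then
      M.hyperTerm s (M.muU c x v i j) - M.hyperTerm s (M.muL c x v i j)
    else 0

end LaneParams

/-! Given the points, each exponential gain averages `exp (-a H)` to `1 / (1 + a)`. The Laplace
transform is thus the mean of the product of `1 / (1 + a y)` over the points `y`, which for a
Poisson process is the exponential of minus the integral of `1 - 1 / (1 + a y)`
(`IsPoissonProcess.integral_exp_neg_tsum`). Interferers lie within `dmax`, so almost surely they are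
finitely many and convergence is not an issue.

For the path loss at hand that integrand is `loss`, an even function of `y - x`. The interferer set
is a disjoint union over the segments, and the two safety zones split each cut segment into four
intervals up to null sets: left or right of the transmitter, left or right of the receiver. On each
interval the integral is a difference of values of `hyperTerm` (`setIntegral_loss_reach`).

That `hyperTerm` is an antiderivative of `loss` on the half-line of distances follows from Euler's
integral for `₂F₁`: it is analytic on `z < 1` and has the Gauss series near `0`, hence is the
continuation. -/

/-! ### The Euler integral of `₂F₁(1, 1/α; 1 + 1/α; z)` -/

/-- The integral `∫₀¹ du / (1 - z u ^ α)`, which is `₂F₁(1, 1/α; 1 + 1/α; z)` for `z < 1`. -/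
noncomputable def eulerIntegral (α z : ℝ) : ℝ := ∫ u in (0 : ℝ)..1, 1 / (1 - z * u ^ α)

/-- The right side is affine in `w`, so it is smallest at an endpoint of `[0, 1]`. -/
theorem min_one_sub_le_one_sub_mul {z w : ℝ} (hw0 : 0 ≤ w) (hw1 : w ≤ 1) :
    min 1 (1 - z) ≤ 1 - z * w := by
  rcases le_total z 0 with hz | hz
  · exact (min_le_left _ _).trans (by nlinarith)
  · exact (min_le_right _ _).trans (by nlinarith)

/-- Geometric expansion of the integrand with ratio `z u^α / (1 - z₀ u^α)`, integrated termwise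
under a geometric bound. General `z₀` gives analyticity; `z₀ = 0` gives the Gauss series. -/
theorem hasSum_eulerIntegral {α : ℝ} (hα : 0 < α) {z₀ z : ℝ} (hz₀ : z₀ < 1)
    (hz : |z| < min 1 (1 - z₀)) :
    HasSum (fun n : ℕ => z ^ n * ∫ u in (0 : ℝ)..1, (u ^ α) ^ n / (1 - z₀ * u ^ α) ^ (n + 1))
      (eulerIntegral α (z₀ + z)) := by
  set m := min 1 (1 - z₀) with hm
  have hm0 : 0 < m := lt_min one_pos (by linarith)
  have hq : |z| / m < 1 := (div_lt_one hm0).2 hz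
  have hq0 : 0 ≤ |z| / m := by positivity
  have hpow : ∀ u ∈ uIoc (0 : ℝ) 1, 0 ≤ u ^ α ∧ u ^ α ≤ 1 := by
    intro u hu
    rw [uIoc_of_le zero_le_one] at hu
    exact ⟨Real.rpow_nonneg hu.1.le _, Real.rpow_le_one hu.1.le hu.2 hα.le⟩
  have hsum : Summable fun n : ℕ => m⁻¹ * (|z| / m) ^ n :=
    (summable_geometric_of_lt_one hq0 hq).mul_left _
  simp_rw [← intervalIntegral.integral_const_mul]
  refine intervalIntegral.hasSum_integral_of_dominated_convergence
    (fun n _ => m⁻¹ * (|z| / m) ^ n) (fun n => ?_) (fun n => ?_) ?_ ?_ ?_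
  · exact Measurable.aestronglyMeasurable (by fun_prop)
  · refine Filter.Eventually.of_forall fun u hu => ?_
    obtain ⟨h0, h1⟩ := hpow u hu
    have hb : m ≤ 1 - z₀ * u ^ α := min_one_sub_le_one_sub_mul h0 h1
    have hb0 := hm0.trans_le hb
    rw [Real.norm_eq_abs, abs_mul, abs_pow, abs_div, abs_pow, abs_of_nonneg h0,
      abs_of_pos (pow_pos hb0 _)]
    have h2 : (u ^ α) ^ n / (1 - z₀ * u ^ α) ^ (n + 1) ≤ 1 / m ^ (n + 1) := by
      gcongr
      exact pow_le_one₀ h0 h1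
    calc _ ≤ |z| ^ n * (1 / m ^ (n + 1)) := by gcongr
      _ = _ := by rw [div_pow, pow_succ]; field_simp
  · exact Filter.Eventually.of_forall fun _ _ => hsum
  · exact intervalIntegrable_const
  · refine Filter.Eventually.of_forall fun u hu => ?_
    obtain ⟨h0, h1⟩ := hpow u hu
    have hb : m ≤ 1 - z₀ * u ^ α := min_one_sub_le_one_sub_mul h0 h1
    have hb0 := hm0.trans_le hb
    have hr : |z * u ^ α / (1 - z₀ * u ^ α)| < 1 := by
      rw [abs_div, abs_mul, abs_of_nonneg h0, abs_of_pos hb0, div_lt_one hb0]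
      nlinarith [abs_nonneg z]
    have h := (hasSum_geometric_of_abs_lt_one hr).mul_left (1 - z₀ * u ^ α)⁻¹
    have hden : 1 - z * u ^ α / (1 - z₀ * u ^ α)
        = (1 - (z₀ + z) * u ^ α) / (1 - z₀ * u ^ α) := by
      rw [eq_div_iff hb0.ne', sub_mul, div_mul_cancel₀ _ hb0.ne']
      ring
    have hval : 1 / (1 - (z₀ + z) * u ^ α)
        = (1 - z₀ * u ^ α)⁻¹ * (1 - z * u ^ α / (1 - z₀ * u ^ α))⁻¹ := by
      rw [hden, inv_div, ← mul_div_assoc, inv_mul_cancel₀ hb0.ne']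
    rw [hval]
    refine h.congr_fun fun n => ?_
    rw [div_pow, mul_pow, pow_succ, div_mul_eq_div_div_swap]
    ring

theorem analyticOnNhd_eulerIntegral {α : ℝ} (hα : 0 < α) :
    AnalyticOnNhd ℝ (eulerIntegral α) (Iio 1) := by
  intro z₀ hz₀
  refine ⟨FormalMultilinearSeries.ofScalars ℝ fun n =>
    ∫ u in (0 : ℝ)..1, (u ^ α) ^ n / (1 - z₀ * u ^ α) ^ (n + 1), ?_⟩
  rw [hasFPowerSeriesAt_iff]
  have hm : 0 < min 1 (1 - z₀) := lt_min one_pos (by linarith [mem_Iio.1 hz₀])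
  filter_upwards [Metric.ball_mem_nhds (0 : ℝ) hm] with z hz
  simpa [FormalMultilinearSeries.coeff_ofScalars] using
    hasSum_eulerIntegral hα hz₀ (z := z) (by simpa using hz)

/-- With `b = 1/α` this collapses the quotient of Pochhammer symbols in the series to `1 / (α n +
1)`, the integral of `u^(α n)`. -/
theorem ascPochhammer_eval_one_add_mul (b : ℝ) (n : ℕ) :
    (ascPochhammer ℝ n).eval (1 + b) * b = (ascPochhammer ℝ n).eval b * (b + n) := by
  induction n with
  | zero => simp
  | succ n ih =>
    rw [ascPochhammer_succ_eval, ascPochhammer_succ_eval, mul_right_comm, ih]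
    push_cast
    ring

theorem eulerIntegral_eq_ordinaryHypergeometric {α : ℝ} (hα : 0 < α) {z : ℝ}
    (hz : z ∈ Ioo (-1 : ℝ) 1) :
    eulerIntegral α z = ₂F₁ (1 : ℝ) (1 / α) (1 + 1 / α) z := by
  have h := hasSum_eulerIntegral hα (z₀ := 0) (z := z) one_pos (by simpa using abs_lt.2 hz)
  rw [zero_add] at h
  rw [← h.tsum_eq, ordinaryHypergeometric_eq_tsum]
  refine tsum_congr fun n => ?_
  have hint : ∫ u in (0 : ℝ)..1, (u ^ α) ^ n / (1 - 0 * u ^ α) ^ (n + 1) = 1 / (α * n + 1) := by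
    have : ∫ u in (0 : ℝ)..1, (u ^ α) ^ n / (1 - 0 * u ^ α) ^ (n + 1)
        = ∫ u in (0 : ℝ)..1, u ^ (α * n) := by
      refine intervalIntegral.integral_congr fun u hu => ?_
      rw [uIcc_of_le zero_le_one] at hu
      simp [Real.rpow_mul hu.1]
    have hn : 0 ≤ α * n := by positivity
    rw [this, integral_rpow (Or.inl (by linarith)), Real.one_rpow,
      Real.zero_rpow (by linarith), sub_zero]
  have hpos : 0 < (ascPochhammer ℝ n).eval (1 + 1 / α) := ascPochhammer_pos n _ (by positivity)
  have hrec := ascPochhammer_eval_one_add_mul (1 / α) n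
  rw [hint, ascPochhammer_eval_one, smul_eq_mul, mul_comm]
  congr 1
  have hfac : (n.factorial : ℝ) ≠ 0 := by positivity
  have hn : 0 < α * n + 1 := by positivity
  rw [inv_mul_cancel₀ hfac, one_mul, ← div_eq_mul_inv, div_eq_div_iff hn.ne' hpos.ne', one_mul]
  field_simp at hrec ⊢
  linarith

theorem gaussF_eq_eulerIntegral {α : ℝ} (hα : 0 < α) {z : ℝ} (hz : z < 1) :
    gaussF 1 (1 / α) (1 + 1 / α) z = eulerIntegral α z := by
  have hE : IsGaussContinuation 1 (1 / α) (1 + 1 / α) (eulerIntegral α) :=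
    ⟨analyticOnNhd_eulerIntegral hα, fun z hz => eulerIntegral_eq_ordinaryHypergeometric hα hz⟩
  have hex : ∃ F, IsGaussContinuation 1 (1 / α) (1 + 1 / α) F := ⟨_, hE⟩
  rw [gaussF, dif_pos hex]
  exact hex.choose_spec.eqOn hE hz

/-- `hyperTerm` is an antiderivative of `1 / (1 + (τ t) ^ α / (s ρ))`. -/
theorem LaneParams.hyperTerm_eq_integral (M : LaneParams) (htau : 0 < M.tau)
    (halpha : 0 < M.alpha) (hrho : 0 < M.rho) {s mu : ℝ} (hs : 0 < s) (hmu : 0 ≤ mu) :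
    M.hyperTerm s mu
      = ∫ t in (0 : ℝ)..mu, 1 / (1 + (M.tau * t) ^ M.alpha / (s * M.rho)) := by
  have hneg : (M.tau * mu) ^ M.alpha / (-(s * M.rho)) < 1 := by
    rw [div_neg]
    have : 0 ≤ (M.tau * mu) ^ M.alpha / (s * M.rho) := by positivity
    linarith
  -- Substitution `t = mu * u`; with the factor `mu` outside it also covers `mu = 0`.
  have h := intervalIntegral.mul_integral_comp_mul_left (a := 0) (b := 1)
    (f := fun t => 1 / (1 + (M.tau * t) ^ M.alpha / (s * M.rho))) mu
  rw [mul_zero, mul_one] at h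
  rw [hyperTerm, gaussF_eq_eulerIntegral halpha hneg, eulerIntegral, ← h]
  congr 1
  refine intervalIntegral.integral_congr fun u hu => ?_
  rw [uIcc_of_le zero_le_one] at hu
  have : (M.tau * (mu * u)) ^ M.alpha = (M.tau * mu) ^ M.alpha * u ^ M.alpha := by
    rw [← mul_assoc, Real.mul_rpow (by positivity) hu.1]
  simp only [this]
  congr 1
  rw [div_neg]
  ring

/-! ### The Laplace functional of a Poisson process -/

theorem finprod_eq_prod_of_eq_one_off {Ω : Type*} {X : ℕ → Ω → ℝ} {u : ℝ → ℝ}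
    {A : Set ℝ} (huA : ∀ y ∉ A, u y = 1) {ω : Ω} (hω : {i | X i ω ∈ A}.Finite) :
    ∏ᶠ i, u (X i ω) = ∏ i ∈ hω.toFinset, u (X i ω) := by
  refine finprod_eq_prod_of_mulSupport_subset _ fun i hi => ?_
  by_contra hiA
  exact hi (huA _ (by simpa using hiA))

/-- The default value `1` of `∏ᶠ` also lies in the interval, so the bound holds for every `ω`. -/
theorem finprod_mem_Icc {Ω : Type*} {X : ℕ → Ω → ℝ} {u : ℝ → ℝ}
    (hu : ∀ y, u y ∈ Icc (0 : ℝ) 1) (ω : Ω) :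
    ∏ᶠ i, u (X i ω) ∈ Icc (0 : ℝ) 1 :=
  finprod_induction (fun t => t ∈ Icc (0 : ℝ) 1) ⟨zero_le_one, le_rfl⟩
    (fun _ _ ha hb => ⟨mul_nonneg ha.1 hb.1, mul_le_one₀ ha.2 hb.1 hb.2⟩) fun _ => hu _

theorem tendsto_prod_range_of_finite {f : ℕ → ℝ} {s : Finset ℕ} (hf : ∀ i ∉ s, f i = 1) :
    Filter.Tendsto (fun n => ∏ i ∈ Finset.range n, f i) Filter.atTop
      (nhds (∏ i ∈ s, f i)) := by
  obtain ⟨N, hN⟩ := s.exists_nat_subset_range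
  refine tendsto_const_nhds.congr' ?_
  filter_upwards [Filter.eventually_ge_atTop N] with n hn
  exact Finset.prod_subset (hN.trans (Finset.range_mono hn)) fun i _ hi => hf i hi

theorem toNat_pointCount {Ω : Type*} {X : ℕ → Ω → ℝ} {A : Set ℝ} {ω : Ω}
    (hω : {i | X i ω ∈ A}.Finite) :
    (pointCount X A ω).toNat = hω.toFinset.card := by
  rw [pointCount, hω.encard_eq_coe_toFinset_card, ENat.toNat_natCast]

section Poisson

variable {Ω : Type*} [MeasurableSpace Ω] {P : Measure Ω} {X : ℕ → Ω → ℝ} {ν : Measure ℝ}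

theorem IsPoissonProcess.ae_finite (hX : IsPoissonProcess P X ν) {A : Set ℝ}
    (hA : MeasurableSet A) (hνA : ν A ≠ ⊤) : ∀ᵐ ω ∂P, {i | X i ω ∈ A}.Finite := by
  have h : ∀ᵐ ω ∂P, pointCount X A ω ≠ ⊤ := by
    rw [(hX.poisson A hA hνA).ae_iff (p := fun n : ℕ∞ => n ≠ ⊤) (Measurable.of_discrete),
      ae_map_iff (Measurable.of_discrete).aemeasurable (MeasurableSet.of_discrete)]
    exact Filter.Eventually.of_forall fun n => ENat.natCast_ne_top n
  filter_upwards [h] with ω hω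
  exact Set.encard_ne_top_iff.1 hω

theorem IsPoissonProcess.integral_pow_pointCount (hX : IsPoissonProcess P X ν) {A : Set ℝ}
    (hA : MeasurableSet A) (hνA : ν A ≠ ⊤) (z : ℝ) :
    ∫ ω, z ^ (pointCount X A ω).toNat ∂P = Real.exp (-((1 - z) * ν.real A)) := by
  have h := (hX.poisson A hA hνA).integral_comp (f := fun n : ℕ∞ => z ^ n.toNat)
    Measurable.of_discrete.aestronglyMeasurable
  simp only [Function.comp_apply] at h
  rw [h, integral_map_cast_poissonMeasure]
  set r : ℝ := ((ν A).toNNReal : ℝ) with hr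
  have hr' : ν.real A = r := rfl
  have hexp : Real.exp (r * z) = ∑' n : ℕ, (r * z) ^ n / n.factorial := by
    rw [Real.exp_eq_exp_ℝ, NormedSpace.exp_eq_tsum_div]
  rw [hr', show -((1 - z) * r) = -r + r * z by ring, Real.exp_add, hexp, ← tsum_mul_left]
  refine tsum_congr fun n => ?_
  simp only [ENat.toNat_natCast, smul_eq_mul, mul_pow]
  ring

theorem IsPoissonProcess.ae_tendsto_prod_range (hX : IsPoissonProcess P X ν) {A : Set ℝ}
    (hA : MeasurableSet A) (hνA : ν A ≠ ⊤) {u : ℝ → ℝ} (huA : ∀ y ∉ A, u y = 1) :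
    ∀ᵐ ω ∂P, Filter.Tendsto (fun n => ∏ i ∈ Finset.range n, u (X i ω)) Filter.atTop
      (nhds (∏ᶠ i, u (X i ω))) := by
  filter_upwards [hX.ae_finite hA hνA] with ω hω
  rw [finprod_eq_prod_of_eq_one_off huA hω]
  exact tendsto_prod_range_of_finite fun i hi => huA _ (by simpa using hi)

/-- The product is an almost sure limit of measurable partial products. -/
theorem IsPoissonProcess.aestronglyMeasurable_finprod (hX : IsPoissonProcess P X ν) {A : Set ℝ}
    (hA : MeasurableSet A) (hνA : ν A ≠ ⊤) {u : ℝ → ℝ} (hu : Measurable u)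
    (huA : ∀ y ∉ A, u y = 1) : AEStronglyMeasurable (fun ω => ∏ᶠ i, u (X i ω)) P := by
  refine aestronglyMeasurable_of_tendsto_ae Filter.atTop (fun n => ?_)
    (hX.ae_tendsto_prod_range hA hνA huA)
  exact (Finset.measurable_fun_prod _ fun i _ => hu.comp (hX.measurable i)).aestronglyMeasurable

/-- Grouping the points by the value `k` of `u` turns the product into powers of `k` whose exponents
are independent Poisson counts; each factor is a Poisson generating function. -/
theorem IsPoissonProcess.integral_finprod_simpleFunc [IsProbabilityMeasure P]
    (hX : IsPoissonProcess P X ν) {A : Set ℝ} (hA : MeasurableSet A) (hνA : ν A ≠ ⊤)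
    (u : SimpleFunc ℝ ℝ) (huA : ∀ y ∉ A, u y = 1) :
    ∫ ω, ∏ᶠ i, u (X i ω) ∂P = Real.exp (-∫ y, (1 - u y) ∂ν) := by
  classical
  -- Cutting by `A` keeps the intensity finite, also for the level set of the value `1`.
  let B : u.range → Set ℝ := fun k => A ∩ u ⁻¹' {k.1}
  have hB : ∀ k, MeasurableSet (B k) := fun k => hA.inter (u.measurableSet_fiber _)
  have hBfin : ∀ k, ν (B k) ≠ ⊤ := fun k => measure_ne_top_of_subset inter_subset_left hνA
  have hdisj : Pairwise fun k l => Disjoint (B k) (B l) := by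
    intro k l hkl
    rw [Set.disjoint_left]
    rintro y ⟨-, hk⟩ ⟨-, hl⟩
    exact hkl (Subtype.ext (hk.symm.trans hl))
  have hindep : iIndepFun (fun k => pointCount X (B k)) P := by
    have e := u.range.equivFin
    rw [← iIndepFun_precomp_of_bijective e.symm.bijective]
    exact hX.indep _ (fun j => B (e.symm j)) (fun j => hB _)
      fun i j hij => hdisj (e.symm.injective.ne hij)
  have hprod : (fun ω => ∏ᶠ i, u (X i ω))
      =ᵐ[P] fun ω => ∏ k : u.range, k.1 ^ (pointCount X (B k) ω).toNat := by
    filter_upwards [hX.ae_finite hA hνA] with ω hω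
    rw [finprod_eq_prod_of_eq_one_off huA hω,
      ← Finset.prod_fiberwise_of_maps_to (s := hω.toFinset) (t := u.range)
        (g := fun i => u (X i ω)) (fun i _ => u.mem_range_self _), ← Finset.prod_coe_sort]
    refine Finset.prod_congr rfl fun k _ => ?_
    have hfin : {i | X i ω ∈ B k}.Finite := hω.subset fun i hi => hi.1
    rw [toNat_pointCount hfin, Finset.prod_congr rfl (g := fun _ => k.1)
      (fun i hi => (Finset.mem_filter.1 hi).2), Finset.prod_const]
    congr 2
    ext i
    simp [B]
  have hint : ∫ y, (1 - u y) ∂ν = ∑ k : u.range, (1 - k.1) * ν.real (B k) := by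
    have hsum : (fun y => 1 - u y)
        = fun y => ∑ k : u.range, (B k).indicator (fun _ => 1 - k.1) y := by
      funext y
      by_cases hy : y ∈ A
      · rw [Finset.sum_eq_single ⟨u y, u.mem_range_self y⟩]
        · simp [B, hy]
        · intro k _ hk
          refine indicator_of_notMem (fun hyk => hk (Subtype.ext hyk.2.symm)) _
        · simp
      · rw [huA y hy, sub_self]
        exact (Finset.sum_eq_zero fun k _ => indicator_of_notMem (fun h => hy h.1) _).symm
    rw [hsum, integral_finsetSum]
    · refine Finset.sum_congr rfl fun k _ => ?_
      rw [integral_indicator_const _ (hB k), smul_eq_mul, mul_comm]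
    · intro k _
      exact (integrable_indicator_iff (hB k)).2 (integrableOn_const (hBfin k))
  have hcomp := hindep.comp (fun k n => k.1 ^ n.toNat) fun k => Measurable.of_discrete
  rw [integral_congr_ae hprod, hint, ← Finset.sum_neg_distrib, Real.exp_sum]
  refine (hcomp.integral_fun_prod_eq_prod_integral fun k => ?_).trans
    (Finset.prod_congr rfl fun k _ => hX.integral_pow_pointCount (hB k) (hBfin k) _)
  exact (Measurable.of_discrete.comp_aemeasurable
    (hX.poisson _ (hB k) (hBfin k)).aemeasurable).aestronglyMeasurable

/-- The generating functional of a Poisson process. -/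
theorem IsPoissonProcess.integral_finprod [IsProbabilityMeasure P]
    (hX : IsPoissonProcess P X ν) {A : Set ℝ} (hA : MeasurableSet A) (hνA : ν A ≠ ⊤)
    {u : ℝ → ℝ} (hu : Measurable u) (hu01 : ∀ y, u y ∈ Icc (0 : ℝ) 1)
    (huA : ∀ y ∉ A, u y = 1) :
    ∫ ω, ∏ᶠ i, u (X i ω) ∂P = Real.exp (-∫ y, (1 - u y) ∂ν) := by
  have h1 : (1 : ℝ) ∈ Icc (0 : ℝ) 1 := ⟨zero_le_one, le_rfl⟩
  -- Approximants reset to `1` off `A`, so that the simple case applies with the same `A` and only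
  -- finitely many factors matter.
  let w : ℕ → SimpleFunc ℝ ℝ := fun n =>
    SimpleFunc.piecewise A hA (SimpleFunc.approxOn u hu (Icc 0 1) 1 h1 n) (SimpleFunc.const ℝ 1)
  have hwA : ∀ n, ∀ y ∉ A, w n y = 1 := fun n y hy => by simp [w, hy]
  have hw01 : ∀ n y, w n y ∈ Icc (0 : ℝ) 1 := by
    intro n y
    by_cases hy : y ∈ A
    · simpa [w, hy] using SimpleFunc.approxOn_mem hu h1 n y
    · rw [hwA n y hy]; exact h1
  have hlim : ∀ y, Filter.Tendsto (fun n => w n y) Filter.atTop (nhds (u y)) := by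
    intro y
    by_cases hy : y ∈ A
    · simpa [w, hy] using SimpleFunc.tendsto_approxOn hu h1 (subset_closure (hu01 y))
    · simp [hwA _ y hy, huA y hy]
  have hleft : Filter.Tendsto (fun n => ∫ ω, ∏ᶠ i, w n (X i ω) ∂P) Filter.atTop
      (nhds (∫ ω, ∏ᶠ i, u (X i ω) ∂P)) := by
    refine tendsto_integral_of_dominated_convergence (fun _ => 1)
      (fun n => hX.aestronglyMeasurable_finprod hA hνA (w n).measurable (hwA n))
      (integrable_const _) (fun n => Filter.Eventually.of_forall fun ω => ?_) ?_
    · have h := finprod_mem_Icc (X := X) (hw01 n) ω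
      rw [Real.norm_eq_abs, abs_of_nonneg h.1]
      exact h.2
    · filter_upwards [hX.ae_finite hA hνA] with ω hω
      simp_rw [finprod_eq_prod_of_eq_one_off (hwA _) hω, finprod_eq_prod_of_eq_one_off huA hω]
      exact tendsto_finsetProd _ fun i _ => hlim _
  have hright : Filter.Tendsto (fun n => ∫ y, (1 - w n y) ∂ν) Filter.atTop
      (nhds (∫ y, (1 - u y) ∂ν)) := by
    refine tendsto_integral_of_dominated_convergence (A.indicator fun _ => 1)
      (fun n => (measurable_const.sub (w n).measurable).aestronglyMeasurable)
      ((integrable_indicator_iff hA).2 (integrableOn_const hνA))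
      (fun n => Filter.Eventually.of_forall fun y => ?_)
      (Filter.Eventually.of_forall fun y => tendsto_const_nhds.sub (hlim y))
    by_cases hy : y ∈ A
    · have h := hw01 n y
      rw [indicator_of_mem hy, Real.norm_eq_abs, abs_of_nonneg (by linarith [h.2])]
      linarith [h.1]
    · simp [hy, hwA n y hy]
  simp_rw [hX.integral_finprod_simpleFunc hA hνA (w _) (hwA _)] at hleft
  exact tendsto_nhds_unique hleft ((Real.continuous_exp.tendsto _).comp hright.neg)

end Poisson

/-! ### Rayleigh fading -/

theorem ae_nonneg_expMeasure_one : ∀ᵐ h ∂expMeasure 1, 0 ≤ h := by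
  rw [ae_iff]
  have : {a : ℝ | ¬0 ≤ a} = Iio 0 := by ext; simp
  rw [this, expMeasure, gammaMeasure, withDensity_apply _ measurableSet_Iio]
  exact lintegral_gammaPDF_of_nonpos le_rfl

/-- The absolute value changes nothing almost surely, but bounds the integrand by `1` everywhere. -/
theorem integral_exp_neg_mul_expMeasure_one {c : ℝ} (hc : 0 ≤ c) :
    ∫ h, Real.exp (-(c * |h|)) ∂expMeasure 1 = 1 / (1 + c) := by
  have hd : expMeasure 1 = volume.withDensity (exponentialPDF 1) := rfl
  have hmeas : Measurable (exponentialPDF 1) :=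
    (measurable_exponentialPDFReal 1).ennreal_ofReal
  rw [hd, integral_withDensity_eq_integral_toReal_smul hmeas
    (Filter.Eventually.of_forall fun _ => ENNReal.ofReal_lt_top)]
  have hfun : (fun h => (exponentialPDF 1 h).toReal • Real.exp (-(c * |h|)))
      = (Ici (0 : ℝ)).indicator fun h => Real.exp (-(1 + c) * h) := by
    funext h
    by_cases hh : 0 ≤ h
    · rw [indicator_of_mem (mem_Ici.2 hh), exponentialPDF_of_nonneg hh, one_mul, one_mul,
        ENNReal.toReal_ofReal (Real.exp_pos _).le, smul_eq_mul, ← Real.exp_add, abs_of_nonneg hh]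
      congr 1
      ring
    · rw [indicator_of_notMem (by simpa using hh), exponentialPDF_of_neg (not_le.1 hh)]
      simp
  rw [hfun, integral_indicator measurableSet_Ici, integral_Ici_eq_integral_Ioi,
    integral_exp_mul_Ioi (by linarith)]
  simp only [mul_zero, Real.exp_zero]
  rw [neg_div_neg_eq]

section Fading

variable {Ω : Type*} [MeasurableSpace Ω] {P : Measure Ω}
  {X H : ℕ → Ω → ℝ} {ν : Measure ℝ}

theorem IsRayleighFading.ae_nonneg (hH : IsRayleighFading P X H) : ∀ᵐ ω ∂P, ∀ i, 0 ≤ H i ω := by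
  rw [ae_all_iff]
  intro i
  rw [(hH.exponential i).ae_iff (p := fun h => 0 ≤ h)
    (measurableSet_setOfPred.1 measurableSet_Ici)]
  exact ae_nonneg_expMeasure_one

theorem IsRayleighFading.integral_prod_exp (hH : IsRayleighFading P X H) (n : ℕ) {a : ℕ → ℝ}
    (ha : ∀ i, 0 ≤ a i) :
    ∫ ω, ∏ i ∈ Finset.range n, Real.exp (-(a i * |H i ω|)) ∂P
      = ∏ i ∈ Finset.range n, 1 / (1 + a i) := by
  simp_rw [Finset.prod_range]
  have hmeas : ∀ i, Measurable fun h : ℝ => Real.exp (-(a i * |h|)) := fun i => by fun_prop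
  have hindep := (hH.indep.precomp (Fin.val_injective (n := n))).comp
    (fun i h => Real.exp (-(a i * |h|))) fun i => hmeas i
  refine (hindep.integral_fun_prod_eq_prod_integral fun i => ?_).trans
    (Finset.prod_congr rfl fun i _ => ?_)
  · exact ((hmeas i).comp_aemeasurable (hH.exponential i).aemeasurable).aestronglyMeasurable
  · exact ((hH.exponential i).integral_comp (hmeas i).aestronglyMeasurable).trans
      (integral_exp_neg_mul_expMeasure_one (ha i))

/-- Averaging over the fading gains of the first `n` points. -/
theorem IsRayleighFading.integral_prod_exp_comp [IsProbabilityMeasure P]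
    (hH : IsRayleighFading P X H)
    (hX : ∀ i, Measurable (X i)) (n : ℕ) {a : ℝ → ℝ} (ha : Measurable a) (ha0 : ∀ y, 0 ≤ a y) :
    ∫ ω, ∏ i ∈ Finset.range n, Real.exp (-(a (X i ω) * |H i ω|)) ∂P
      = ∫ ω, ∏ i ∈ Finset.range n, 1 / (1 + a (X i ω)) ∂P := by
  have hHm : AEMeasurable (fun ω i => H i ω) P :=
    aemeasurable_pi_iff.2 fun i => (hH.exponential i).aemeasurable
  have hXm : Measurable fun ω i => X i ω := measurable_pi_iff.2 hX
  let g : (ℕ → ℝ) × (ℕ → ℝ) → ℝ := fun p =>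
    ∏ i ∈ Finset.range n, Real.exp (-(a (p.1 i) * |p.2 i|))
  have hg : Measurable g := by
    refine Finset.measurable_fun_prod _ fun i _ => ?_
    have h1 : Measurable fun p : (ℕ → ℝ) × (ℕ → ℝ) => a (p.1 i) :=
      ha.comp ((measurable_pi_apply i).comp measurable_fst)
    have h2 : Measurable fun p : (ℕ → ℝ) × (ℕ → ℝ) => |p.2 i| :=
      measurable_abs.comp ((measurable_pi_apply i).comp measurable_snd)
    exact Real.measurable_exp.comp (h1.mul h2).neg
  -- Independence of the two sequences makes their joint law a product, so Fubini allows the gains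
  -- to be averaged with the points frozen.
  have hlaw := (indepFun_iff_map_prod_eq_prod_map_map hXm.aemeasurable hHm).1
    hH.indep_points.symm
  have : IsProbabilityMeasure (P.map fun ω i => X i ω) :=
    Measure.isProbabilityMeasure_map hXm.aemeasurable
  have : IsProbabilityMeasure (P.map fun ω i => H i ω) := Measure.isProbabilityMeasure_map hHm
  have hgint : Integrable g ((P.map fun ω i => X i ω).prod (P.map fun ω i => H i ω)) := by
    refine Integrable.of_bound hg.aestronglyMeasurable 1 (Filter.Eventually.of_forall fun p => ?_)
    rw [Real.norm_eq_abs, Finset.abs_prod]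
    refine Finset.prod_le_one (fun i _ => abs_nonneg _) fun i _ => ?_
    rw [Real.abs_exp, Real.exp_le_one_iff, neg_nonpos]
    exact mul_nonneg (ha0 _) (abs_nonneg _)
  calc ∫ ω, ∏ i ∈ Finset.range n, Real.exp (-(a (X i ω) * |H i ω|)) ∂P
      = ∫ p, g p ∂(P.map fun ω => (fun i => X i ω, fun i => H i ω)) :=
        (integral_map (hXm.aemeasurable.prodMk hHm) hg.aestronglyMeasurable).symm
    _ = ∫ y, ∫ h, g (y, h) ∂(P.map fun ω i => H i ω) ∂(P.map fun ω i => X i ω) := by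
        rw [hlaw, integral_prod _ hgint]
    _ = ∫ y, ∏ i ∈ Finset.range n, 1 / (1 + a (y i)) ∂(P.map fun ω i => X i ω) := by
        refine integral_congr_ae (Filter.Eventually.of_forall fun y => ?_)
        have h := integral_map hHm
          (hg.comp (measurable_prodMk_left (x := y))).aestronglyMeasurable
        exact h.trans (hH.integral_prod_exp n fun i => ha0 (y i))
    _ = _ := by
        refine integral_map hXm.aemeasurable (Measurable.aestronglyMeasurable ?_)
        refine Finset.measurable_fun_prod _ fun i _ => ?_
        exact measurable_const.div (measurable_const.add (ha.comp (measurable_pi_apply i)))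

/-- The Laplace functional of a Poisson process with Rayleigh fading. -/
theorem IsPoissonProcess.integral_exp_neg_tsum [IsProbabilityMeasure P]
    (hX : IsPoissonProcess P X ν) (hH : IsRayleighFading P X H) {A : Set ℝ}
    (hA : MeasurableSet A) (hνA : ν A ≠ ⊤)
    {a : ℝ → ℝ} (ha : Measurable a) (ha0 : ∀ y, 0 ≤ a y) (haA : ∀ y ∉ A, a y = 0) :
    ∫ ω, Real.exp (-∑' i, a (X i ω) * H i ω) ∂P
      = Real.exp (-∫ y, (1 - 1 / (1 + a y)) ∂ν) := by
  have hu : Measurable fun y => 1 / (1 + a y) := measurable_const.div (measurable_const.add ha)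
  have hu01 : ∀ y, 1 / (1 + a y) ∈ Icc (0 : ℝ) 1 := fun y => by
    have := ha0 y
    exact ⟨by positivity, by rw [div_le_one (by positivity)]; linarith⟩
  have huA : ∀ y ∉ A, 1 / (1 + a y) = 1 := fun y hy => by simp [haA y hy]
  rw [← hX.integral_finprod (u := fun y => 1 / (1 + a y)) hA hνA hu hu01 huA]
  -- The gains are averaged in finite products only. Almost surely these are eventually constant in
  -- `n`, and they are bounded by `1`.
  have hleft : Filter.Tendsto
      (fun n => ∫ ω, ∏ i ∈ Finset.range n, Real.exp (-(a (X i ω) * |H i ω|)) ∂P) Filter.atTop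
      (nhds (∫ ω, Real.exp (-∑' i, a (X i ω) * H i ω) ∂P)) := by
    refine tendsto_integral_of_dominated_convergence (fun _ => 1) (fun n => ?_)
      (integrable_const _) (fun n => Filter.Eventually.of_forall fun ω => ?_) ?_
    · refine (Finset.aemeasurable_fun_prod _ fun i _ => ?_).aestronglyMeasurable
      exact Real.measurable_exp.comp_aemeasurable ((ha.comp (hX.measurable i)).aemeasurable.mul
        (measurable_abs.comp_aemeasurable (hH.exponential i).aemeasurable)).neg
    · rw [Real.norm_eq_abs, Finset.abs_prod]
      refine Finset.prod_le_one (fun i _ => abs_nonneg _) fun i _ => ?_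
      rw [Real.abs_exp, Real.exp_le_one_iff, neg_nonpos]
      exact mul_nonneg (ha0 _) (abs_nonneg _)
    · filter_upwards [hX.ae_finite hA hνA, hH.ae_nonneg] with ω hω hpos
      have h0 : ∀ i ∉ hω.toFinset, a (X i ω) = 0 := fun i hi => haA _ (by simpa using hi)
      rw [tsum_eq_sum (s := hω.toFinset) fun i hi => by rw [h0 i hi, zero_mul],
        ← Finset.sum_neg_distrib, Real.exp_sum]
      simp_rw [fun i => abs_of_nonneg (hpos i)]
      exact tendsto_prod_range_of_finite fun i hi => by simp [h0 i hi]
  have hright : Filter.Tendsto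
      (fun n => ∫ ω, ∏ i ∈ Finset.range n, 1 / (1 + a (X i ω)) ∂P) Filter.atTop
      (nhds (∫ ω, ∏ᶠ i, 1 / (1 + a (X i ω)) ∂P)) := by
    refine tendsto_integral_of_dominated_convergence (fun _ => 1) (fun n => ?_)
      (integrable_const _) (fun n => Filter.Eventually.of_forall fun ω => ?_)
      (hX.ae_tendsto_prod_range (u := fun y => 1 / (1 + a y)) hA hνA huA)
    · exact (Finset.measurable_fun_prod _ fun i _ =>
        hu.fun_comp (hX.measurable i)).aestronglyMeasurable
    · rw [Real.norm_eq_abs, Finset.abs_prod]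
      refine Finset.prod_le_one (fun i _ => abs_nonneg _) fun i _ => ?_
      have h := hu01 (X i ω)
      rw [abs_of_nonneg h.1]
      exact h.2
  simp_rw [hH.integral_prod_exp_comp hX.measurable _ ha ha0] at hleft
  exact tendsto_nhds_unique hleft hright

end Fading

/-! ### Integration over the interferer positions -/

/-- Endpoints are null, so it never matters which ends `B` contains; for `b ≤ a` the set `B` is
null. -/
theorem setIntegral_eq_intervalIntegral_of_subset {F : ℝ → ℝ} {a b : ℝ} {B : Set ℝ}
    (h₁ : Ioo a b ⊆ B) (h₂ : B ⊆ Icc a b) :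
    ∫ y in B, F y = if a < b then ∫ y in a..b, F y else 0 := by
  split_ifs with hab
  · rw [intervalIntegral.integral_of_le hab.le]
    refine setIntegral_congr_set (Filter.EventuallyLE.antisymm ?_ ?_)
    · exact h₂.eventuallyLE.trans Ioc_ae_eq_Icc.symm.le
    · exact Ioo_ae_eq_Ioc.symm.le.trans h₁.eventuallyLE
  · refine setIntegral_measure_zero _ (measure_mono_null h₂ ?_)
    rw [Real.volume_Icc, ENNReal.ofReal_eq_zero]
    linarith

namespace LaneParams

variable (M : LaneParams)

/-- The probability `1 - 1 / (1 + s ρ (τ |t|) ^ (-α))`, in the form that is continuous at `0`. -/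
noncomputable def loss (s t : ℝ) : ℝ := 1 / (1 + (M.tau * |t|) ^ M.alpha / (s * M.rho))

variable {M}

theorem loss_mem_Icc (htau : 0 < M.tau) (hrho : 0 < M.rho) {s : ℝ} (hs : 0 < s) (t : ℝ) :
    M.loss s t ∈ Icc (0 : ℝ) 1 := by
  have h : 0 ≤ (M.tau * |t|) ^ M.alpha / (s * M.rho) := by positivity
  exact ⟨by unfold loss; positivity, by rw [loss, div_le_one (by positivity)]; linarith⟩

theorem continuous_loss (htau : 0 < M.tau) (halpha : 0 < M.alpha) (hrho : 0 < M.rho) {s : ℝ}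
    (hs : 0 < s) : Continuous (M.loss s) := by
  refine continuous_const.div (continuous_const.add (Continuous.div_const ?_ _)) fun t => ?_
  · exact (Real.continuous_rpow_const halpha.le).comp (continuous_const.mul continuous_abs)
  · positivity

theorem hyperTerm_sub_eq_integral (htau : 0 < M.tau) (halpha : 0 < M.alpha) (hrho : 0 < M.rho)
    {s a b : ℝ} (hs : 0 < s) (ha : 0 ≤ a) (hb : 0 ≤ b) :
    M.hyperTerm s b - M.hyperTerm s a = ∫ t in a..b, M.loss s t := by
  have hloss : ∀ mu, 0 ≤ mu → M.hyperTerm s mu = ∫ t in (0 : ℝ)..mu, M.loss s t := by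
    intro mu hmu
    rw [M.hyperTerm_eq_integral htau halpha hrho hs hmu]
    refine intervalIntegral.integral_congr fun t ht => ?_
    rw [uIcc_of_le hmu] at ht
    simp only [loss, abs_of_nonneg ht.1]
  have hint : ∀ a b, IntervalIntegrable (M.loss s) volume a b :=
    (continuous_loss htau halpha hrho hs).intervalIntegrable
  rw [hloss a ha, hloss b hb, intervalIntegral.integral_interval_sub_left (hint _ _) (hint _ _)]

theorem setIntegral_loss_right (htau : 0 < M.tau) (halpha : 0 < M.alpha) (hrho : 0 < M.rho)
    {s x L U : ℝ} (hs : 0 < s) (hL : 0 ≤ L) {B : Set ℝ} (h₁ : ∀ y, y - x ∈ Ioo L U → y ∈ B)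
    (h₂ : ∀ y ∈ B, y - x ∈ Icc L U) :
    ∫ y in B, M.loss s (y - x)
      = if L < U then M.hyperTerm s U - M.hyperTerm s L else 0 := by
  rw [setIntegral_eq_intervalIntegral_of_subset (a := L + x) (b := U + x)
    (fun y hy => h₁ y ⟨by linarith [hy.1], by linarith [hy.2]⟩)
    (fun y hy => ⟨by linarith [(h₂ y hy).1], by linarith [(h₂ y hy).2]⟩)]
  simp only [add_lt_add_iff_right]
  split_ifs with h
  · rw [intervalIntegral.integral_comp_sub_right (fun t => M.loss s t), add_sub_cancel_right,
      add_sub_cancel_right, hyperTerm_sub_eq_integral htau halpha hrho hs hL (hL.trans h.le)]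
  · rfl

/-- Reflection at `x`: `loss` is even, so the distance `x - y` serves as variable. -/
theorem setIntegral_loss_left (htau : 0 < M.tau) (halpha : 0 < M.alpha) (hrho : 0 < M.rho)
    {s x L U : ℝ} (hs : 0 < s) (hL : 0 ≤ L) {B : Set ℝ} (h₁ : ∀ y, x - y ∈ Ioo L U → y ∈ B)
    (h₂ : ∀ y ∈ B, x - y ∈ Icc L U) :
    ∫ y in B, M.loss s (y - x)
      = if L < U then M.hyperTerm s U - M.hyperTerm s L else 0 := by
  rw [setIntegral_eq_intervalIntegral_of_subset (a := x - U) (b := x - L)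
    (fun y hy => h₁ y ⟨by linarith [hy.2], by linarith [hy.1]⟩)
    (fun y hy => ⟨by linarith [(h₂ y hy).2], by linarith [(h₂ y hy).1]⟩)]
  simp only [sub_lt_sub_iff_left]
  split_ifs with h
  · have heven : ∀ y, M.loss s (y - x) = M.loss s (x - y) := fun y => by
      rw [loss, loss, abs_sub_comm]
    simp_rw [heven]
    rw [intervalIntegral.integral_comp_sub_left (fun t => M.loss s t), sub_sub_cancel,
      sub_sub_cancel, hyperTerm_sub_eq_integral htau halpha hrho hs hL (hL.trans h.le)]
  · rfl

variable (M)

/-- The part of the `c`-th segment within distance `dmax` of `x`. -/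
def reach (c : ℤ) (x : ℝ) : Set ℝ := {y | y ∈ M.segment c ∧ |y - x| ≤ M.dmax}

variable {M}

theorem sub_mem_Icc_of_mem_reach {c : ℤ} {x y : ℝ} (hy : y ∈ M.reach c x) :
    y - x ∈ Icc (M.left c x) (M.right c x) := by
  obtain ⟨⟨h1, h2⟩, h3⟩ := hy
  obtain ⟨h4, h5⟩ := abs_le.1 h3
  exact ⟨max_le (by linarith) h4, le_min (by linarith) h5⟩

theorem mem_reach_of_sub_mem_Ioo {c : ℤ} {x y : ℝ}
    (hy : y - x ∈ Ioo (M.left c x) (M.right c x)) : y ∈ M.reach c x := by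
  obtain ⟨h1, h2⟩ := hy
  obtain ⟨h3, h4⟩ := max_lt_iff.1 h1
  obtain ⟨h5, h6⟩ := lt_min_iff.1 h2
  exact ⟨⟨by linarith, by linarith⟩, abs_le.2 ⟨h4.le, h6.le⟩⟩

theorem measurableSet_reach (c : ℤ) (x : ℝ) : MeasurableSet (M.reach c x) :=
  measurableSet_Ico.inter
    (measurableSet_le (measurable_id.sub_const x).abs measurable_const)

theorem integrableOn_loss (htau : 0 < M.tau) (halpha : 0 < M.alpha) (hrho : 0 < M.rho)
    {s : ℝ} (hs : 0 < s) (x : ℝ) {B : Set ℝ} (hB : volume B ≠ ⊤) :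
    IntegrableOn (fun y => M.loss s (y - x)) B := by
  have hcont : Continuous fun y => M.loss s (y - x) :=
    (continuous_loss htau halpha hrho hs).comp (continuous_id.sub continuous_const)
  refine Measure.integrableOn_of_bounded (M := 1) hB hcont.aestronglyMeasurable
    (Filter.Eventually.of_forall fun y => ?_)
  have h := loss_mem_Icc htau hrho hs (y - x) (M := M)
  rw [Real.norm_eq_abs, abs_of_nonneg h.1]
  exact h.2

theorem interferers_subset_Icc (x v : ℝ) :
    M.interferers x v ⊆ Icc (x - M.dmax) (x + M.dmax) := by
  rintro y ⟨-, hy, -⟩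
  obtain ⟨h1, h2⟩ := abs_le.1 hy
  exact ⟨by linarith, by linarith⟩

theorem volume_interferers_ne_top (x v : ℝ) : volume (M.interferers x v) ≠ ⊤ :=
  measure_ne_top_of_subset (interferers_subset_Icc x v) isCompact_Icc.measure_ne_top

/-- `ζ` is the integral of `loss` over the interferer positions in one segment. -/
theorem setIntegral_loss_reach (hdsafe : 0 ≤ M.dsafe) (htau : 0 < M.tau) (halpha : 0 < M.alpha)
    (hrho : 0 < M.rho) {s : ℝ} (hs : 0 < s) (c : ℤ) (x v : ℝ) :
    ∫ y in M.reach c x ∩ {y | M.dsafe < |y - x| ∧ M.dsafe < |y - v|}, M.loss s (y - x)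
      = M.zeta c s x v := by
  -- Index `i` is the side of the transmitter `v`, index `j` the side of the receiver `x`, as in
  -- `muL` and `muU`.
  let B : Fin 2 → Fin 2 → Set ℝ := fun i j => M.reach c x ∩
    ((if i = 0 then Ioi (v + M.dsafe) else Iio (v - M.dsafe)) ∩
      (if j = 0 then Ioi (x + M.dsafe) else Iio (x - M.dsafe)))
  have hmeas : ∀ i j, MeasurableSet (B i j) := by
    intro i j
    refine (measurableSet_reach c x).inter (MeasurableSet.inter ?_ ?_) <;> split_ifs <;>
      measurability
  have hunion : M.reach c x ∩ {y | M.dsafe < |y - x| ∧ M.dsafe < |y - v|}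
      = (B 0 0 ∪ B 0 1) ∪ (B 1 0 ∪ B 1 1) := by
    ext y
    simp only [B, mem_inter_iff, mem_ofPred_eq, lt_abs, mem_union, if_true, one_ne_zero, if_false,
      mem_Ioi, mem_Iio]
    constructor
    · rintro ⟨h, h1 | h1, h2 | h2⟩
      · exact Or.inl (Or.inl ⟨h, by linarith, by linarith⟩)
      · exact Or.inr (Or.inl ⟨h, by linarith, by linarith⟩)
      · exact Or.inl (Or.inr ⟨h, by linarith, by linarith⟩)
      · exact Or.inr (Or.inr ⟨h, by linarith, by linarith⟩)
    · rintro ((⟨h, h1, h2⟩ | ⟨h, h1, h2⟩) | (⟨h, h1, h2⟩ | ⟨h, h1, h2⟩))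
      · exact ⟨h, Or.inl (by linarith), Or.inl (by linarith)⟩
      · exact ⟨h, Or.inr (by linarith), Or.inl (by linarith)⟩
      · exact ⟨h, Or.inl (by linarith), Or.inr (by linarith)⟩
      · exact ⟨h, Or.inr (by linarith), Or.inr (by linarith)⟩
  have hdisj : ∀ i, Disjoint (B i 0) (B i 1) := by
    intro i
    refine disjoint_left.2 ?_
    rintro y ⟨-, -, h1⟩ ⟨-, -, h2⟩
    simp only [if_true, one_ne_zero, if_false, mem_Ioi, mem_Iio] at h1 h2
    linarith
  have hdisj' : Disjoint (B 0 0 ∪ B 0 1) (B 1 0 ∪ B 1 1) := by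
    refine disjoint_left.2 ?_
    rintro y (⟨-, h1, -⟩ | ⟨-, h1, -⟩) (⟨-, h2, -⟩ | ⟨-, h2, -⟩) <;>
    · simp only [if_true, one_ne_zero, if_false, mem_Ioi, mem_Iio] at h1 h2
      linarith
  have hreach : volume (M.reach c x) ≠ ⊤ :=
    measure_ne_top_of_subset (fun y hy => hy.1)
      (by rw [segment, Real.volume_Ico]; exact ENNReal.ofReal_ne_top)
  have hint : ∀ i j, IntegrableOn (fun y => M.loss s (y - x)) (B i j) := fun i j =>
    integrableOn_loss htau halpha hrho hs x (measure_ne_top_of_subset inter_subset_left hreach)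
  have hpiece : ∀ i j, ∫ y in B i j, M.loss s (y - x)
      = if M.muL c x v i j < M.muU c x v i j then
          M.hyperTerm s (M.muU c x v i j) - M.hyperTerm s (M.muL c x v i j) else 0 := by
    intro i j
    fin_cases i <;> fin_cases j
    · refine setIntegral_loss_right htau halpha hrho hs ?_ ?_ ?_
      · exact hdsafe.trans ((le_max_left _ _).trans (le_max_right _ _))
      · rintro y ⟨h1, h2⟩
        simp only [muL, muU, max_lt_iff] at h1 h2
        exact ⟨mem_reach_of_sub_mem_Ioo ⟨h1.1, h2⟩,
          show y ∈ Ioi _ by rw [mem_Ioi]; linarith, show y ∈ Ioi _ by rw [mem_Ioi]; linarith⟩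
      · rintro y ⟨h, h1, h2⟩
        simp only [Fin.zero_eta, if_true, mem_Ioi] at h1 h2
        obtain ⟨h3, h4⟩ := sub_mem_Icc_of_mem_reach h
        exact ⟨max_le h3 (max_le (by linarith) (by linarith)), h4⟩
    -- Left of the receiver the distance is `x - y`, so the bounds on `y - x` are negated and change
    -- roles.
    · refine setIntegral_loss_left htau halpha hrho hs ?_ ?_ ?_
      · have := min_le_right (M.right c x) (-M.dsafe)
        simp only [muL]
        linarith
      · rintro y ⟨h1, h2⟩
        simp only [muL, muU] at h1 h2
        obtain ⟨h3, h4⟩ := lt_min_iff.1 (show y - x < min _ _ by linarith)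
        obtain ⟨h5, h6⟩ := max_lt_iff.1 (show max _ _ < y - x by linarith)
        exact ⟨mem_reach_of_sub_mem_Ioo ⟨h5, h3⟩,
          show y ∈ Ioi _ by rw [mem_Ioi]; linarith, show y ∈ Iio _ by rw [mem_Iio]; linarith⟩
      · rintro y ⟨h, h1, h2⟩
        simp only [Fin.zero_eta, Fin.mk_one, if_true, one_ne_zero, if_false, mem_Ioi,
          mem_Iio] at h1 h2
        obtain ⟨h3, h4⟩ := sub_mem_Icc_of_mem_reach h
        have h5 : y - x ≤ min (M.right c x) (-M.dsafe) := le_min h4 (by linarith)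
        have h6 : max (M.left c x) (M.dsafe - x + v) ≤ y - x := max_le h3 (by linarith)
        simp only [muL, muU]
        exact ⟨by linarith, by linarith⟩
    · refine setIntegral_loss_right htau halpha hrho hs ?_ ?_ ?_
      · exact hdsafe.trans (le_max_right _ _)
      · rintro y ⟨h1, h2⟩
        simp only [muL, muU, max_lt_iff, lt_min_iff] at h1 h2
        exact ⟨mem_reach_of_sub_mem_Ioo ⟨h1.1, h2.1⟩,
          show y ∈ Iio _ by rw [mem_Iio]; linarith, show y ∈ Ioi _ by rw [mem_Ioi]; linarith⟩
      · rintro y ⟨h, h1, h2⟩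
        simp only [Fin.zero_eta, Fin.mk_one, if_true, one_ne_zero, if_false, mem_Ioi,
          mem_Iio] at h1 h2
        obtain ⟨h3, h4⟩ := sub_mem_Icc_of_mem_reach h
        exact ⟨max_le h3 (by linarith), le_min h4 (by linarith)⟩
    · refine setIntegral_loss_left htau halpha hrho hs ?_ ?_ ?_
      · have := (min_le_right (M.right c x) (min (-M.dsafe) (v - x - M.dsafe))).trans
          (min_le_left _ _)
        simp only [muL]
        linarith
      · rintro y ⟨h1, h2⟩
        simp only [muL, muU] at h1 h2
        obtain ⟨h3, h4⟩ := lt_min_iff.1 (show y - x < min _ (min _ _) by linarith)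
        obtain ⟨h5, h6⟩ := lt_min_iff.1 h4
        exact ⟨mem_reach_of_sub_mem_Ioo ⟨by linarith, h3⟩,
          show y ∈ Iio _ by rw [mem_Iio]; linarith, show y ∈ Iio _ by rw [mem_Iio]; linarith⟩
      · rintro y ⟨h, h1, h2⟩
        simp only [Fin.mk_one, one_ne_zero, if_false, mem_Iio] at h1 h2
        obtain ⟨h3, h4⟩ := sub_mem_Icc_of_mem_reach h
        have h5 : y - x ≤ min (M.right c x) (min (-M.dsafe) (v - x - M.dsafe)) :=
          le_min h4 (le_min (by linarith) (by linarith))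
        simp only [muL, muU]
        exact ⟨by linarith, by linarith⟩
  rw [hunion, setIntegral_union hdisj' ((hmeas _ _).union (hmeas _ _))
      ((hint _ _).union (hint _ _)) ((hint _ _).union (hint _ _)),
    setIntegral_union (hdisj 0) (hmeas _ _) (hint _ _) (hint _ _),
    setIntegral_union (hdisj 1) (hmeas _ _) (hint _ _) (hint _ _), zeta, Fin.sum_univ_two,
    Fin.sum_univ_two, Fin.sum_univ_two]
  simp only [hpiece]

/-! ### Summation over the segments -/

theorem interferers_eq_iUnion (x v : ℝ) : M.interferers x v
    = ⋃ c, M.reach c x ∩ {y | M.dsafe < |y - x| ∧ M.dsafe < |y - v|} := by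
  ext y
  simp only [interferers, coChannel, reach, mem_ofPred_eq, mem_iUnion, mem_inter_iff]
  constructor
  · rintro ⟨⟨c, hc⟩, h1, h2⟩
    exact ⟨c, ⟨hc, h1⟩, h2⟩
  · rintro ⟨c, ⟨hc, h1⟩, h2⟩
    exact ⟨⟨c, hc⟩, h1, h2⟩

theorem measurableSet_reach_inter (c : ℤ) (x v : ℝ) :
    MeasurableSet (M.reach c x ∩ {y | M.dsafe < |y - x| ∧ M.dsafe < |y - v|}) :=
  (measurableSet_reach c x).inter
    ((measurableSet_lt measurable_const (measurable_id.sub_const x).abs).inter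
      (measurableSet_lt measurable_const (measurable_id.sub_const v).abs))

theorem measurableSet_interferers (x v : ℝ) : MeasurableSet (M.interferers x v) := by
  rw [interferers_eq_iUnion]
  exact MeasurableSet.iUnion fun c => measurableSet_reach_inter c x v

/-- Centers are at least `nAR * dA ≥ dA` apart, and the segments are half-open of length `dA`. -/
theorem pairwise_disjoint_segment (hnAR : 1 ≤ M.nAR) (hdA : 0 < M.dA) :
    Pairwise fun c d => Disjoint (M.segment c) (M.segment d) := by
  have key : ∀ c d : ℤ, c < d → Disjoint (M.segment c) (M.segment d) := by
    intro c d hcd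
    refine disjoint_left.2 ?_
    rintro y ⟨-, h1⟩ ⟨h2, -⟩
    have h3 : (c : ℝ) + 1 ≤ d := by exact_mod_cast hcd
    have h4 : (1 : ℝ) ≤ M.nAR := by exact_mod_cast hnAR
    have h5 : M.dA ≤ M.nAR * M.dA := by nlinarith
    nlinarith
  intro c d hcd
  rcases lt_or_gt_of_ne hcd with h | h
  · exact key c d h
  · exact (key d c h).symm

theorem setIntegral_loss_interferers (hnAR : 1 ≤ M.nAR) (hdA : 0 < M.dA) (hdsafe : 0 ≤ M.dsafe)
    (htau : 0 < M.tau) (halpha : 0 < M.alpha) (hrho : 0 < M.rho) {s : ℝ} (hs : 0 < s)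
    (x v : ℝ) :
    ∫ y in M.interferers x v, M.loss s (y - x) = ∑' c, M.zeta c s x v := by
  have hint := integrableOn_loss htau halpha hrho hs x (volume_interferers_ne_top (M := M) x v)
  rw [interferers_eq_iUnion] at hint ⊢
  rw [integral_iUnion (fun c => measurableSet_reach_inter c x v) (fun c d hcd => ?_) hint]
  · exact tsum_congr fun c => setIntegral_loss_reach hdsafe htau halpha hrho hs c x v
  · exact (pairwise_disjoint_segment hnAR hdA hcd).mono (fun y hy => hy.1.1) fun y hy => hy.1.1

/-! ### Segments out of reach -/

theorem left_lt_right_of_zeta_ne_zero {c : ℤ} {s x v : ℝ} (h : M.zeta c s x v ≠ 0) :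
    M.left c x < M.right c x := by
  contrapose! h
  refine Finset.sum_eq_zero fun i _ => Finset.sum_eq_zero fun j _ => if_neg ?_
  rw [not_lt]
  fin_cases i <;> fin_cases j
  · exact h.trans (le_max_left _ _)
  · exact neg_le_neg ((min_le_left _ _).trans (h.trans (le_max_left _ _)))
  · exact (min_le_left _ _).trans (h.trans (le_max_left _ _))
  · exact neg_le_neg ((min_le_left _ _).trans h)

theorem reach_bounds_of_zeta_ne_zero {c : ℤ} {s x v : ℝ} (h : M.zeta c s x v ≠ 0) :
    c * (M.nAR * M.dA) - M.dA / 2 < M.dmax + x ∧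
      -(c * (M.nAR * M.dA)) - M.dA / 2 < M.dmax - x := by
  have h1 := left_lt_right_of_zeta_ne_zero h
  have h2 := (le_max_left _ _).trans_lt (h1.trans_le (min_le_right _ _))
  have h3 := (le_max_right _ _).trans_lt (h1.trans_le (min_le_left _ _))
  rw [mul_assoc] at h2 h3
  exact ⟨by linarith, by linarith⟩

theorem finite_zeta_ne_zero (hnAR : 1 ≤ M.nAR) (hdA : 0 < M.dA) (s x v : ℝ) :
    {c : ℤ | M.zeta c s x v ≠ 0}.Finite := by
  have hN : 0 < M.nAR * M.dA := mul_pos (by exact_mod_cast hnAR) hdA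
  refine (finite_Icc ⌊-(M.dmax - x + M.dA / 2) / (M.nAR * M.dA)⌋
    ⌈(M.dmax + x + M.dA / 2) / (M.nAR * M.dA)⌉).subset fun c hc => ?_
  obtain ⟨h1, h2⟩ := reach_bounds_of_zeta_ne_zero hc
  constructor
  · have : -(M.dmax - x + M.dA / 2) / (M.nAR * M.dA) < c := by
      rw [div_lt_iff₀ hN]; linarith
    exact_mod_cast (Int.floor_le _).trans this.le
  · have : (c : ℝ) < (M.dmax + x + M.dA / 2) / (M.nAR * M.dA) := by
      rw [lt_div_iff₀ hN]; linarith
    exact_mod_cast this.le.trans (Int.le_ceil _)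

/-- The hypotheses say that segment `-(m + 1)` ends at or before `x - dmax` and segment `n + 1`
starts at or after `x + dmax`; segments further out are then out of reach too. -/
theorem tsum_zeta_eq_sum (hnAR : 1 ≤ M.nAR) (hdA : 0 < M.dA) {s x v : ℝ} {m n : ℤ}
    (hm : M.dmax - x ≤ (m + 1) * (M.nAR * M.dA) - M.dA / 2)
    (hn : M.dmax + x ≤ (n + 1) * (M.nAR * M.dA) - M.dA / 2) :
    ∑' c, M.zeta c s x v = ∑ c ∈ Finset.Icc (-m) n, M.zeta c s x v := by
  have hN : 0 < M.nAR * M.dA := mul_pos (by exact_mod_cast hnAR) hdA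
  refine tsum_eq_sum fun c hc => ?_
  contrapose! hc
  obtain ⟨h1, h2⟩ := reach_bounds_of_zeta_ne_zero hc
  have h3 : (c : ℝ) < n + 1 := lt_of_mul_lt_mul_right (by linarith) hN.le
  have h4 : (-c : ℝ) < m + 1 := lt_of_mul_lt_mul_right (by linarith) hN.le
  have h5 : c < n + 1 := by exact_mod_cast h3
  have h6 : -c < m + 1 := by exact_mod_cast h4
  rw [Finset.mem_Icc]
  omega

end LaneParams

/-! ### The Laplace transform of the interference -/

theorem lemma3 {Ω : Type*} [MeasurableSpace Ω] (P : Measure Ω) [IsProbabilityMeasure P]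
    (M : LaneParams) (hlam : 0 < M.lam) (hpa : 0 < M.pa) (hpa_le : M.pa ≤ 1)
    (hnAR : 1 ≤ M.nAR) (hdA : 0 < M.dA) (hdsafe : 0 ≤ M.dsafe) (hdmax : 0 < M.dmax)
    (htau : 0 < M.tau) (halpha : 0 < M.alpha) (hrho : 0 < M.rho)
    (X H : ℕ → Ω → ℝ)
    (hX : IsPoissonProcess P X (ENNReal.ofReal (M.lam * M.pa) • (volume : Measure ℝ)))
    (hH : IsRayleighFading P X H)
    (x v : ℝ) :
    (∀ᵐ ω ∂P, Summable fun i => M.received x v (X i ω) (H i ω)) ∧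
    ∀ s : ℝ, 0 < s →
      {c : ℤ | M.zeta c s x v ≠ 0}.Finite ∧
      ∫ ω, Real.exp (-s * M.interference X H x v ω) ∂P
        = Real.exp (-(M.lam * M.pa * ∑' c : ℤ, M.zeta c s x v)) ∧
      (M.dmax - x ≤ (⌊M.dmax / (M.nAR * M.dA)⌋ + 1) * (M.nAR * M.dA) - M.dA / 2 →
        M.dmax + x ≤ (⌈M.dmax / (M.nAR * M.dA)⌉ + 1) * (M.nAR * M.dA) - M.dA / 2 →
        ∫ ω, Real.exp (-s * M.interference X H x v ω) ∂P
          = Real.exp (-(M.lam * M.pa *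
              ∑ c ∈ Finset.Icc (-⌊M.dmax / (M.nAR * M.dA)⌋) ⌈M.dmax / (M.nAR * M.dA)⌉,
                M.zeta c s x v))) := by
  classical
  let S := M.interferers x v
  have hSm : MeasurableSet S := LaneParams.measurableSet_interferers x v
  have hSν : (ENNReal.ofReal (M.lam * M.pa) • (volume : Measure ℝ)) S ≠ ⊤ := by
    rw [Measure.smul_apply, smul_eq_mul]
    exact ENNReal.mul_ne_top ENNReal.ofReal_ne_top (LaneParams.volume_interferers_ne_top x v)
  refine ⟨?_, fun s hs => ?_⟩
  · filter_upwards [hX.ae_finite hSm hSν] with ω hω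
    refine summable_of_ne_finset_zero (s := hω.toFinset) fun i hi => if_neg ?_
    simpa using hi
  · have hlap : ∫ ω, Real.exp (-s * M.interference X H x v ω) ∂P
        = Real.exp (-(M.lam * M.pa * ∑' c : ℤ, M.zeta c s x v)) := by
      let a : ℝ → ℝ := S.indicator fun y => s * ((M.tau * |y - x|) ^ (-M.alpha) * M.rho)
      have ha : Measurable a := by
        refine Measurable.indicator ?_ hSm
        fun_prop
      have ha0 : ∀ y, 0 ≤ a y := indicator_nonneg fun y _ => by positivity
      have haS : ∀ y ∉ S, a y = 0 := fun y hy => indicator_of_notMem hy _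
      -- Moving `s` inside the real `∑'` needs no summability, so this holds for every `ω`.
      have hsum : ∀ ω, -s * M.interference X H x v ω = -∑' i, a (X i ω) * H i ω := by
        intro ω
        rw [LaneParams.interference, neg_mul, ← tsum_mul_left]
        congr 1
        refine tsum_congr fun i => ?_
        by_cases hi : X i ω ∈ M.interferers x v
        · simp only [LaneParams.received, a, S, hi, if_true, indicator_of_mem]
          ring
        · simp [LaneParams.received, a, S, hi]
      have hloss : (fun y => 1 - 1 / (1 + a y))
          = S.indicator fun y => M.loss s (y - x) := by
        funext y
        by_cases hy : y ∈ S
        -- An interferer is farther than `dsafe ≥ 0` from `x`, so the negative power is a genuine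
        -- reciprocal.
        · have hpos : 0 < M.tau * |y - x| := mul_pos htau (hdsafe.trans_lt hy.2.2.1)
          have hpow := Real.rpow_pos_of_pos hpos M.alpha
          simp only [a, indicator_of_mem hy, LaneParams.loss]
          rw [Real.rpow_neg hpos.le]
          field_simp
          ring
        · simp [a, hy]
      simp_rw [hsum]
      rw [hX.integral_exp_neg_tsum hH hSm hSν ha ha0 haS, hloss, integral_indicator hSm,
        Measure.restrict_smul, integral_smul_measure,
        LaneParams.setIntegral_loss_interferers hnAR hdA hdsafe htau halpha hrho hs,
        ENNReal.toReal_ofReal (mul_pos hlam hpa).le, smul_eq_mul]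
    refine ⟨LaneParams.finite_zeta_ne_zero hnAR hdA s x v, hlap, fun h₁ h₂ => ?_⟩
    rw [hlap, LaneParams.tsum_zeta_eq_sum hnAR hdA h₁ h₂]
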